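/- Let $f:\mathbb R^N\to\mathbb R\cup\{+\infty\}$ be a standard self-concordant function, i.e. a closed convex function with open domain $\operatorname{dom} f$, three times continuously differentiable on $\operatorname{dom} f$, such that for all $x\in\operatorname{dom} f$ and $u\in\mathbb R^N$ the function $\psi(t)=f(x+tu)$ satisfies $|\psi'''(0)|\le 2\,\psi''(0)^{3/2}$. Assume that $\nabla^2 f$ is positive definite on $\operatorname{dom} f$ and that $F:=f$ (the composite objective $F=f+g$ with $g=0$) has a unique minimizer; let $F^*=\min F$. Put $$\omega(t)=t-\ln(1+t),\qquad \omega_*(t)=-t-\ln(1-t),$$ and let $\omega_*^{-1}:[0,\infty)\to[0,1)$ be the inverse of $\omega_*$ restricted to $[0,1)$. Let $x^0\in\operatorname{dom} f$, and let $0<\lambda\le L$ be such that $\lambda I\preceq\nabla^2 f(x)\preceq LI$ for all $x\in\operatorname{dom} f$ with $F(x)\le F(x^0)$. Let $\{x^k\}$ be generated from $x^0$ by the inexact damped Newton method of Zhang and Xiao: for each $k\ge 0$, any vector $v^k$ with $$\|\nabla^2 f(x^k)v^k-\nabla f(x^k)\|\le\tfrac1{20}\sqrt{\lambda/L}\;\|\nabla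 f(x^k)\|$$ is chosen, and $$x^{k+1}=x^k-\frac{v^k}{1+\sqrt{\langle v^k,\nabla^2 f(x^k)v^k\rangle}}.$$ Let $\epsilon>0$, $\delta_0=F(x^0)-F^*$, and $t_+=\max(t,0)$. Then all iterates $x^k$ lie in $\operatorname{dom} f$, and the method requires at most $$\min\left\{\left\lceil\left[\frac{\log\left(\frac12\omega(1/6)\right)-\log\delta_0}{\log\left(1-\frac{1-\omega_*^{-1}(\delta_0)}{2(1+\omega_*^{-1}(\delta_0))}\right)}\right]_+\right\rceil,\ \left\lceil\frac{2\delta_0}{\omega(1/6)}\right\rceil\right\}+\left\lceil\left[\log_2\frac{2\omega(1/6)}{\epsilon}\right]_+\right\rceil$$ iterations for finding some $x^k$ with $F(x^k)-F^*\le\epsilon$ (if $\delta_0=0$, the minimum is read as $0$). -/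

import Mathlib

namespace InexactDN

/-- The Euclidean space of dimension `N` with its standard inner product. -/
abbrev E (N : ℕ) : Type := EuclideanSpace ℝ (Fin N)

/-- `ω(t) = t - ln(1 + t)`. -/
noncomputable def omega (t : ℝ) : ℝ := t - Real.log (1 + t)

/-- `ω_*(t) = -t - ln(1 - t)`. -/
noncomputable def omegaStar (t : ℝ) : ℝ := -t - Real.log (1 - t)

/-- `ω_*⁻¹`, the inverse function of `ω_*` restricted to `[0, 1)`
(a bijection of `[0, 1)` onto `[0, ∞)`). -/
noncomputable def omegaStarInv : ℝ → ℝ :=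
  Function.invFunOn omegaStar (Set.Ico 0 1)

/-- The Hessian `∇²f(x)`, as a continuous linear operator: the derivative of the gradient. -/
noncomputable def hess {N : ℕ} (f : E N → ℝ) (x : E N) : E N →L[ℝ] E N :=
  fderiv ℝ (gradient f) x

/-- The local norm `‖u‖_x = √⟨u, ∇²f(x) u⟩`. -/
noncomputable def localNorm {N : ℕ} (f : E N → ℝ) (x u : E N) : ℝ :=
  √(inner ℝ u (hess f x u))

/-- A function `ℝ^N → ℝ ∪ {∞}` is given by its domain `D` (where it is finite) and its values
`f x` for `x ∈ D`; the values of `f` outside `D` are irrelevant.  It is self-concordant with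
parameter `M` if it is a closed convex function with open domain, three times continuously
differentiable on its domain, and `|ψ'''(0)| ≤ M ψ''(0)^{3/2}` for all `x ∈ D` and all
directions `u`, where `ψ(t) = f(x + t u)`. -/
structure IsSelfConcordant {N : ℕ} (M : ℝ) (D : Set (E N)) (f : E N → ℝ) : Prop where
  isOpen_dom : IsOpen D
  convexOn : ConvexOn ℝ D f
  isClosed_epigraph : IsClosed {p : E N × ℝ | p.1 ∈ D ∧ f p.1 ≤ p.2}
  contDiffOn : ContDiffOn ℝ 3 f D
  third_le : ∀ x ∈ D, ∀ u : E N,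
    |iteratedDeriv 3 (fun t : ℝ => f (x + t • u)) 0| ≤
      M * (iteratedDeriv 2 (fun t : ℝ => f (x + t • u)) 0) ^ (3 / 2 : ℝ)

/-- The optimal value `F^* = inf_{x ∈ D} f(x)`. -/
noncomputable def optVal {N : ℕ} (D : Set (E N)) (f : E N → ℝ) : ℝ := sInf (f '' D)

/-- The level set `S(x⁰) = {x : F(x) ≤ F(x⁰)}`. -/
def levelSet {N : ℕ} (D : Set (E N)) (f : E N → ℝ) (x₀ : E N) : Set (E N) :=
  {x | x ∈ D ∧ f x ≤ f x₀}

/-- `lam I ⪯ ∇²f(x) ⪯ L I` for all `x ∈ S`, with `0 < lam ≤ L`. -/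
structure HessianBounds {N : ℕ} (f : E N → ℝ) (S : Set (E N)) (lam L : ℝ) : Prop where
  pos : 0 < lam
  le : lam ≤ L
  lower : ∀ x ∈ S, ∀ u : E N, lam * ‖u‖ ^ 2 ≤ inner ℝ u (hess f x u)
  upper : ∀ x ∈ S, ∀ u : E N, inner ℝ u (hess f x u) ≤ L * ‖u‖ ^ 2

/-- The inexact damped Newton method with tolerances `tol k`: in each iteration a vector `v k` with
`‖∇²f(x k) v k - ∇f(x k)‖ ≤ tol k` is found (in any way), and
`x (k+1) = x k - v k / (1 + ‖v k‖_{x k})`. -/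
structure IsInexactDampedNewton {N : ℕ} (f : E N → ℝ) (tol : ℕ → ℝ) (x v : ℕ → E N) : Prop where
  residual_le : ∀ k, ‖hess f (x k) (v k) - gradient f (x k)‖ ≤ tol k
  update : ∀ k, x (k + 1) = x k - (1 / (1 + localNorm f (x k) (v k))) • v k

end InexactDN

namespace InexactDN

/-! ### Scalar estimates -/

/-! Let `δ k` be the optimality gap and `μ k` the Newton decrement, i.e. the local norm of the exact
Newton direction `n`. Everything follows from two inequalities. Decrease: `δ (k+1) ≤ δ k - 4/5 ω(μ
k)`. The Hessian bounds turn the residual test into `‖v - n‖_x ≤ μ/20` (`localNorm_sub_le`), and the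
self-concordant upper model then applies to the damped step (`inexact_step`). Gap: `δ k ≤ ω_*(μ k)`
if `μ k < 1`, from the lower model, Cauchy-Schwarz and Fenchel-Young (`sub_le_omegaStar`). Since `ω
≥ (1-r)/(1+r) ω_*` on `[0, r]`, a gap of at most `ω_*(r)` forces a relative decrease
(`ratio_mul_le_omega`). Taking `r = ω_*⁻¹(δ 0)` gives the linear rate; while `μ > 1/6` there is also
a constant decrease. Either leads to `μ ≤ 1/6`; from there `r = 1/6` makes the gap at least halve in
each step. -/

theorem sub_le_sub_of_deriv_le {a b a' b' : ℝ → ℝ} {T : ℝ}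
    (ha : ∀ t ∈ Set.Icc 0 T, HasDerivAt a (a' t) t)
    (hb : ∀ t ∈ Set.Icc 0 T, HasDerivAt b (b' t) t)
    (hab : ∀ t ∈ Set.Icc 0 T, a' t ≤ b' t) :
    ∀ t ∈ Set.Icc 0 T, a t - a 0 ≤ b t - b 0 := by
  have hd : ∀ t ∈ Set.Icc 0 T, HasDerivAt (fun t => b t - a t) (b' t - a' t) t :=
    fun t ht => (hb t ht).sub (ha t ht)
  have hm : MonotoneOn (fun t => b t - a t) (Set.Icc 0 T) := by
    refine monotoneOn_of_deriv_nonneg (convex_Icc 0 T)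
      (fun t ht => (hd t ht).continuousAt.continuousWithinAt)
      (fun t ht => (hd t (interior_subset ht)).differentiableAt.differentiableWithinAt) ?_
    intro t ht
    rw [(hd t (interior_subset ht)).deriv]
    exact sub_nonneg.2 (hab t (interior_subset ht))
  intro t ht
  have := hm (Set.left_mem_Icc.2 (ht.1.trans ht.2)) ht ht.1
  simp only at this
  linarith

theorem omega_zero : omega 0 = 0 := by simp [omega]

theorem omegaStar_zero : omegaStar 0 = 0 := by simp [omegaStar]

theorem hasDerivAt_omega {t : ℝ} (ht : 0 ≤ t) : HasDerivAt omega (t / (1 + t)) t := by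
  have h1 : (1 + t) ≠ 0 := by positivity
  have h := (hasDerivAt_id t).sub (((hasDerivAt_id t).const_add 1).log h1)
  refine h.congr_deriv ?_
  simp only [id]
  field_simp
  ring

theorem hasDerivAt_omegaStar {t : ℝ} (ht : t < 1) : HasDerivAt omegaStar (t / (1 - t)) t := by
  have h1 : (1 - t) ≠ 0 := by linarith
  have h := (hasDerivAt_id t).neg.sub (((hasDerivAt_id t).const_sub 1).log h1)
  refine h.congr_deriv ?_
  simp only [id]
  field_simp
  ring

theorem omega_mono {s t : ℝ} (hs : 0 ≤ s) (hst : s ≤ t) : omega s ≤ omega t := by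
  have hm : MonotoneOn omega (Set.Ici 0) := by
    refine monotoneOn_of_deriv_nonneg (convex_Ici 0)
      (fun t ht => (hasDerivAt_omega ht).continuousAt.continuousWithinAt)
      (fun t ht => (hasDerivAt_omega (interior_subset ht)).differentiableAt.differentiableWithinAt)
      ?_
    intro t ht
    have ht' : 0 ≤ t := interior_subset ht
    rw [(hasDerivAt_omega ht').deriv]
    positivity
  exact hm hs (hs.trans hst) hst

theorem omega_nonneg {t : ℝ} (ht : 0 ≤ t) : 0 ≤ omega t :=
  omega_zero ▸ omega_mono le_rfl ht

theorem sq_div_le_omega {t : ℝ} (ht : 0 ≤ t) : t ^ 2 / (1 + t) ≤ 2 * omega t := by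
  have h := sub_le_sub_of_deriv_le (T := t) (a := fun t => t ^ 2 / (1 + t))
    (a' := fun t => (2 * t * (1 + t) - t ^ 2) / (1 + t) ^ 2)
    (b := fun t => 2 * omega t) (b' := fun t => 2 * (t / (1 + t))) ?_ ?_ ?_ t ⟨ht, le_rfl⟩
  · simpa [omega_zero] using h
  · intro s hs
    have h0 : (0 : ℝ) ≤ s := hs.1
    have h1 : (1 + s) ≠ 0 := by positivity
    refine (((hasDerivAt_id s).pow 2).div ((hasDerivAt_id s).const_add 1) h1).congr_deriv ?_
    simp
  · intro s hs
    exact (hasDerivAt_omega hs.1).const_mul 2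
  · intro s hs
    have h0 : (0 : ℝ) ≤ s := hs.1
    rw [← mul_div_assoc, div_le_div_iff₀ (by positivity) (by positivity)]
    have : (2 * s * (1 + s) - s ^ 2) ≤ 2 * s * (1 + s) := by nlinarith
    calc _ ≤ (2 * s * (1 + s)) * (1 + s) := by gcongr
      _ = _ := by ring

theorem omega_pos {t : ℝ} (ht : 0 < t) : 0 < omega t := by
  have h1 := sq_div_le_omega ht.le
  have h2 : 0 < t ^ 2 / (1 + t) := by positivity
  linarith

theorem sq_mul_omega_le {c t : ℝ} (hc : 0 ≤ c) (hc1 : c ≤ 1) (ht : 0 ≤ t) :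
    c ^ 2 * omega t ≤ omega (c * t) := by
  have h := sub_le_sub_of_deriv_le (T := t) (a := fun t => c ^ 2 * omega t)
    (a' := fun t => c ^ 2 * (t / (1 + t)))
    (b := fun t => omega (c * t)) (b' := fun t => (c * t) / (1 + c * t) * c) ?_ ?_ ?_ t ⟨ht, le_rfl⟩
  · simpa [omega_zero] using h
  · intro s hs
    exact (hasDerivAt_omega hs.1).const_mul _
  · intro s hs
    have hcs : 0 ≤ c * s := mul_nonneg hc hs.1
    have h2 : HasDerivAt (fun t => c * t) c s := by
      simpa using (hasDerivAt_id s).const_mul c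
    exact (hasDerivAt_omega hcs).comp s h2
  · intro s hs
    have h0 : (0 : ℝ) ≤ s := hs.1
    calc c ^ 2 * (s / (1 + s)) = (c ^ 2 * s) / (1 + s) := by ring
      _ ≤ (c ^ 2 * s) / (1 + c * s) := by
        gcongr
        nlinarith
      _ = _ := by ring

/-- The derivatives `t/(1-t)` and `t/(1+t)` have ratio `(1+t)/(1-t)`, which is largest at `t = r`.
-/
theorem ratio_mul_omegaStar_le_omega {r s : ℝ} (hs : 0 ≤ s) (hsr : s ≤ r) (hr : r < 1) :
    (1 - r) / (1 + r) * omegaStar s ≤ omega s := by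
  have h := sub_le_sub_of_deriv_le (T := s) (a := fun t => (1 - r) / (1 + r) * omegaStar t)
    (a' := fun t => (1 - r) / (1 + r) * (t / (1 - t)))
    (b := omega) (b' := fun t => t / (1 + t)) ?_ ?_ ?_ s ⟨hs, le_rfl⟩
  · simpa [omega_zero, omegaStar_zero] using h
  · intro t ht
    exact (hasDerivAt_omegaStar (by linarith [ht.2])).const_mul _
  · intro t ht
    exact hasDerivAt_omega ht.1
  · intro t ht
    have h0 : (0 : ℝ) ≤ t := ht.1
    have h1 : 0 < 1 - t := by linarith [ht.2]
    have h2 : 0 < 1 + r := by linarith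
    rw [div_mul_div_comm, div_le_div_iff₀ (by positivity) (by positivity)]
    have : (1 - r) * (1 + t) ≤ (1 + r) * (1 - t) := by linarith [ht.2]
    nlinarith [mul_le_mul_of_nonneg_left this h0]

theorem omegaStar_strictMonoOn : StrictMonoOn omegaStar (Set.Ico 0 1) := by
  refine strictMonoOn_of_deriv_pos (convex_Ico 0 1)
    (fun t ht => (hasDerivAt_omegaStar ht.2).continuousAt.continuousWithinAt) ?_
  intro t ht
  rw [interior_Ico] at ht
  rw [(hasDerivAt_omegaStar ht.2).deriv]
  exact div_pos ht.1 (sub_pos.2 ht.2)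

theorem omegaStar_surjOn : Set.SurjOn omegaStar (Set.Ico 0 1) (Set.Ici 0) := by
  intro d hd
  have hd : 0 ≤ d := hd
  -- Chosen so that `ω_*(s) = d + 1 - s > d`; the intermediate value theorem applies on `[0, s]`.
  set s := 1 - Real.exp (-(d + 1)) with hs
  have he : Real.exp (-(d + 1)) ≤ 1 := Real.exp_le_one_iff.2 (by linarith)
  have hs0 : 0 ≤ s := by linarith
  have hs1 : s < 1 := by linarith [Real.exp_pos (-(d + 1))]
  have hval : omegaStar s = -s + (d + 1) := by
    rw [omegaStar, hs, sub_sub_cancel, Real.log_exp]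
    ring
  have hcont : ContinuousOn omegaStar (Set.Icc 0 s) := fun t ht =>
    (hasDerivAt_omegaStar (ht.2.trans_lt hs1)).continuousAt.continuousWithinAt
  obtain ⟨t, ht, htd⟩ := intermediate_value_Icc hs0 hcont
    (show d ∈ Set.Icc (omegaStar 0) (omegaStar s) from
      ⟨by rw [omegaStar_zero]; exact hd, by rw [hval]; linarith⟩)
  exact ⟨t, ⟨ht.1, ht.2.trans_lt hs1⟩, htd⟩

theorem omegaStarInv_mem {d : ℝ} (hd : 0 ≤ d) : omegaStarInv d ∈ Set.Ico (0 : ℝ) 1 :=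
  Function.invFunOn_mem (omegaStar_surjOn hd)

theorem omegaStar_omegaStarInv {d : ℝ} (hd : 0 ≤ d) : omegaStar (omegaStarInv d) = d :=
  Function.invFunOn_eq (omegaStar_surjOn hd)

/-- The Fenchel-Young inequality for `ω` and `ω_*`. -/
theorem mul_sub_omega_le_omegaStar {m ρ : ℝ} (hm : m < 1) (hρ : 0 ≤ ρ) :
    m * ρ - omega ρ ≤ omegaStar m := by
  have h1 : 0 < 1 + ρ := by linarith
  have h2 : 0 < 1 - m := by linarith
  -- The claim is exactly `log y ≤ y - 1` at `y = (1+ρ)(1-m)`.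
  have h := Real.log_le_sub_one_of_pos (mul_pos h1 h2)
  rw [Real.log_mul h1.ne' h2.ne'] at h
  rw [omega, omegaStar]
  nlinarith

theorem omegaStar_div_one_add {t : ℝ} (ht : 0 ≤ t) :
    omegaStar (t / (1 + t)) = -(t / (1 + t)) + Real.log (1 + t) := by
  have h1 : 1 + t ≠ 0 := by positivity
  have : 1 - t / (1 + t) = (1 + t)⁻¹ := by field_simp; ring
  rw [omegaStar, this, Real.log_inv]
  ring

/-- If `d ≤ ω_*(m)` whenever `m < 1`, then `ω(m)` is at least a fixed fraction of `d`, as long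
as `d ≤ ω_*(r)`. -/
theorem ratio_mul_le_omega {d r m : ℝ} (hd : 0 ≤ d) (hr0 : 0 ≤ r) (hr : r < 1)
    (hdr : d ≤ omegaStar r) (hm : 0 ≤ m) (hdm : m < 1 → d ≤ omegaStar m) :
    (1 - r) / (1 + r) * d ≤ omega m := by
  -- With `d = ω_*(s)` the hypotheses become `s ≤ r` and `s ≤ m`; the case `m ≥ 1` is free because
  -- `s < 1`.
  obtain ⟨s, hs, rfl⟩ := omegaStar_surjOn (Set.mem_Ici.2 hd)
  have hsr : s ≤ r := (omegaStar_strictMonoOn.le_iff_le hs ⟨hr0, hr⟩).1 hdr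
  have hsm : s ≤ m := by
    by_contra! h
    have hm1 := h.trans hs.2
    exact absurd (hdm hm1) (not_le.2 (omegaStar_strictMonoOn ⟨hm, hm1⟩ hs h))
  exact (ratio_mul_omegaStar_le_omega hs.1 hsr hr).trans (omega_mono hs.1 hsm)

/-- The decrease of an inexact damped Newton step: `m` is the Newton decrement, `t` the local norm
of the inexact direction and `p` its inner product with the gradient. -/
theorem omega_le_decrease {m t p : ℝ} (hm : 0 ≤ m) (htm : 19 / 20 * m ≤ t)
    (hp : t ^ 2 - m / 20 * t ≤ p) :
    4 / 5 * omega m ≤ p / (1 + t) - omegaStar (t / (1 + t)) := by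
  have ht : 0 ≤ t := by linarith
  have h1 : 0 < 1 + t := by linarith
  rw [omegaStar_div_one_add ht]
  -- Here `m/20 ≤ t/19`. The right-hand side is then at least `ω(t) - (1/19) t²/(1+t) ≥ (17/19)
  -- ω(t)`, and `(17/19)(19/20)² = 323/400 ≥ 4/5`.
  have hp2 : 18 / 19 * t ^ 2 ≤ p := by nlinarith
  have h2 : 18 / 19 * t ^ 2 / (1 + t) ≤ p / (1 + t) := by gcongr
  have h3 : t ^ 2 / (1 + t) + t / (1 + t) = t := by field_simp; ring
  have h4 := sq_div_le_omega ht
  have h5 := omega_mono (by positivity) htm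
  have h6 := sq_mul_omega_le (c := 19 / 20) (by norm_num) (by norm_num) hm
  have h7 := omega_nonneg hm
  have h8 : omega t = t - Real.log (1 + t) := rfl
  have h9 : 18 / 19 * t ^ 2 / (1 + t) = 18 / 19 * (t ^ 2 / (1 + t)) := by ring
  linarith

/-! ### Self-concordant functions of one variable -/

section OneVariable

variable {φ p q c : ℝ → ℝ} {T : ℝ}

theorem hasDerivAt_inv_sqrt {t : ℝ} (hq : HasDerivAt q (c t) t) (hpos : 0 < q t) :
    HasDerivAt (fun t => (√(q t))⁻¹) (-(c t / (2 * √(q t))) / √(q t) ^ 2) t :=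
  (hq.sqrt hpos.ne').inv (Real.sqrt_pos.2 hpos).ne'

theorem abs_deriv_inv_sqrt_le {a b : ℝ} (hpos : 0 < a) (hb : |b| ≤ 2 * a ^ (3 / 2 : ℝ)) :
    |-(b / (2 * √a)) / √a ^ 2| ≤ 1 := by
  have hs : 0 < √a := Real.sqrt_pos.2 hpos
  have h32 : a ^ (3 / 2 : ℝ) = √a ^ 3 := by
    rw [Real.sqrt_eq_rpow, ← Real.rpow_natCast, ← Real.rpow_mul hpos.le]
    norm_num
  rw [h32] at hb
  rw [neg_div, abs_neg, div_div, abs_div, abs_of_pos (show 0 < 2 * √a * √a ^ 2 by positivity),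
    div_le_one (by positivity)]
  linarith [show 2 * √a * √a ^ 2 = 2 * √a ^ 3 by ring]

/-- Self-concordance says that `q^(-1/2)` has derivative at most `1` in absolute value, where `p, q,
c` stand for `φ', φ'', φ'''`. Integrating the resulting bounds on `q` twice yields `ω` and `ω_*`. -/
theorem second_deriv_bounds
    (hq : ∀ t ∈ Set.Icc 0 T, HasDerivAt q (c t) t) (hpos : ∀ t ∈ Set.Icc 0 T, 0 < q t)
    (hc : ∀ t ∈ Set.Icc 0 T, |c t| ≤ 2 * (q t) ^ (3 / 2 : ℝ)) {t : ℝ} (ht : t ∈ Set.Icc 0 T) :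
    (√(q t))⁻¹ ≤ (√(q 0))⁻¹ + t ∧ (√(q 0))⁻¹ - t ≤ (√(q t))⁻¹ := by
  have hd := fun t ht => hasDerivAt_inv_sqrt (hq t ht) (hpos t ht)
  have hle := fun t ht => abs_le.1 (abs_deriv_inv_sqrt_le (hpos t ht) (hc t ht))
  have h1 := sub_le_sub_of_deriv_le hd (fun t _ => hasDerivAt_id t) (fun t ht => (hle t ht).2) t ht
  have h2 := sub_le_sub_of_deriv_le (fun t _ => (hasDerivAt_id t).neg) hd
    (fun t ht => (hle t ht).1) t ht
  simp only [id, Pi.neg_apply] at h1 h2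
  constructor <;> linarith

theorem lower_bound_one_variable (hT : 0 ≤ T)
    (hφ : ∀ t ∈ Set.Icc 0 T, HasDerivAt φ (p t) t) (hp : ∀ t ∈ Set.Icc 0 T, HasDerivAt p (q t) t)
    (hq : ∀ t ∈ Set.Icc 0 T, HasDerivAt q (c t) t) (hpos : ∀ t ∈ Set.Icc 0 T, 0 < q t)
    (hc : ∀ t ∈ Set.Icc 0 T, |c t| ≤ 2 * (q t) ^ (3 / 2 : ℝ)) :
    φ 0 + p 0 * T + omega (√(q 0) * T) ≤ φ T := by
  set r := √(q 0) with hr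
  have hr0 : 0 < r := Real.sqrt_pos.2 (hpos 0 ⟨le_rfl, hT⟩)
  have hlow : ∀ t ∈ Set.Icc 0 T, r ^ 2 / (1 + r * t) ^ 2 ≤ q t := by
    intro t ht
    have h0 : 0 ≤ t := ht.1
    have hs : 0 < √(q t) := Real.sqrt_pos.2 (hpos t ht)
    have h1 := (second_deriv_bounds hq hpos hc ht).1
    rw [← hr] at h1
    have h2 : r⁻¹ + t = (1 + r * t) / r := by field_simp
    rw [h2, inv_le_comm₀ hs (by positivity), inv_div] at h1
    rw [← Real.sq_sqrt (hpos t ht).le, ← div_pow]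
    gcongr
  have hp1 : ∀ t ∈ Set.Icc 0 T, r - r / (1 + r * t) ≤ p t - p 0 := by
    intro t ht
    have := sub_le_sub_of_deriv_le (a := fun t => -(r / (1 + r * t)))
      (a' := fun t => r ^ 2 / (1 + r * t) ^ 2) ?_ hp hlow t ht
    · simp only [mul_zero, add_zero, div_one] at this
      linarith
    · intro t ht
      have h0 : 0 ≤ t := ht.1
      have h1 : HasDerivAt (fun t => 1 + r * t) r t := by
        simpa using ((hasDerivAt_id t).const_mul r).const_add 1
      refine (((hasDerivAt_const t r).div h1 (by positivity)).neg).congr_deriv ?_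
      ring
  have := sub_le_sub_of_deriv_le (a := fun t => p 0 * t + omega (r * t))
    (a' := fun t => p 0 + (r * t) / (1 + r * t) * r) ?_ hφ ?_ T ⟨hT, le_rfl⟩
  · simp only [mul_zero, omega_zero] at this
    linarith
  · intro t ht
    have h0 : 0 ≤ t := ht.1
    have h2 : HasDerivAt (fun t => r * t) r t := by simpa using (hasDerivAt_id t).const_mul r
    have h3 : HasDerivAt (fun t => p 0 * t) (p 0) t := by
      simpa using (hasDerivAt_id t).const_mul (p 0)
    exact h3.add ((hasDerivAt_omega (by positivity)).comp t h2)
  · intro t ht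
    have h0 : 0 ≤ t := ht.1
    have h1 : (r * t) / (1 + r * t) * r = r - r / (1 + r * t) := by
      have : 1 + r * t ≠ 0 := by positivity
      field_simp
      ring
    linarith [hp1 t ht]

theorem upper_bound_one_variable (hT : 0 ≤ T)
    (hφ : ∀ t ∈ Set.Icc 0 T, HasDerivAt φ (p t) t) (hp : ∀ t ∈ Set.Icc 0 T, HasDerivAt p (q t) t)
    (hq : ∀ t ∈ Set.Icc 0 T, HasDerivAt q (c t) t) (hpos : ∀ t ∈ Set.Icc 0 T, 0 < q t)
    (hc : ∀ t ∈ Set.Icc 0 T, |c t| ≤ 2 * (q t) ^ (3 / 2 : ℝ)) (hT1 : √(q 0) * T < 1) :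
    φ T ≤ φ 0 + p 0 * T + omegaStar (√(q 0) * T) := by
  set r := √(q 0) with hr
  have hr0 : 0 < r := Real.sqrt_pos.2 (hpos 0 ⟨le_rfl, hT⟩)
  have hlt : ∀ t ∈ Set.Icc 0 T, 0 < 1 - r * t := by
    intro t ht
    nlinarith [ht.2]
  have hup : ∀ t ∈ Set.Icc 0 T, q t ≤ r ^ 2 / (1 - r * t) ^ 2 := by
    intro t ht
    have h3 := hlt t ht
    have hs : 0 < √(q t) := Real.sqrt_pos.2 (hpos t ht)
    have h1 := (second_deriv_bounds hq hpos hc ht).2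
    rw [← hr] at h1
    have h2 : r⁻¹ - t = (1 - r * t) / r := by field_simp
    rw [h2, le_inv_comm₀ (by positivity) hs, inv_div] at h1
    rw [← Real.sq_sqrt (hpos t ht).le, ← div_pow]
    gcongr
  have hp1 : ∀ t ∈ Set.Icc 0 T, p t - p 0 ≤ r / (1 - r * t) - r := by
    intro t ht
    have := sub_le_sub_of_deriv_le (b := fun t => r / (1 - r * t))
      (b' := fun t => r ^ 2 / (1 - r * t) ^ 2) hp ?_ hup t ht
    · simp only [mul_zero, sub_zero, div_one] at this
      linarith
    · intro t ht
      have h1 : HasDerivAt (fun t => 1 - r * t) (-r) t := by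
        simpa using ((hasDerivAt_id t).const_mul r).const_sub 1
      refine ((hasDerivAt_const t r).div h1 (hlt t ht).ne').congr_deriv ?_
      ring
  have := sub_le_sub_of_deriv_le (b := fun t => p 0 * t + omegaStar (r * t))
    (b' := fun t => p 0 + (r * t) / (1 - r * t) * r) hφ ?_ ?_ T ⟨hT, le_rfl⟩
  · simp only [mul_zero, omegaStar_zero] at this
    linarith
  · intro t ht
    have h2 : HasDerivAt (fun t => r * t) r t := by simpa using (hasDerivAt_id t).const_mul r
    have h3 : HasDerivAt (fun t => p 0 * t) (p 0) t := by
      simpa using (hasDerivAt_id t).const_mul (p 0)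
    exact h3.add ((hasDerivAt_omegaStar (by linarith [hlt t ht])).comp t h2)
  · intro t ht
    have h1 : (r * t) / (1 - r * t) * r = r / (1 - r * t) - r := by
      have := (hlt t ht).ne'
      field_simp
      ring
    linarith [hp1 t ht]

end OneVariable

end InexactDN
namespace InexactDN

/-! ### Calculus on the domain of a self-concordant function -/

section SelfConcordant

open scoped Topology

variable {N : ℕ} {D : Set (E N)} {f : E N → ℝ} {M : ℝ}

theorem IsSelfConcordant.contDiffAt (hf : IsSelfConcordant M D f) {x : E N} (hx : x ∈ D) :
    ContDiffAt ℝ 3 f x :=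
  hf.contDiffOn.contDiffAt (hf.isOpen_dom.mem_nhds hx)

theorem IsSelfConcordant.hasGradientAt (hf : IsSelfConcordant M D f) {x : E N} (hx : x ∈ D) :
    HasGradientAt f (gradient f x) x :=
  ((hf.contDiffAt hx).differentiableAt (by norm_num)).hasGradientAt

theorem IsSelfConcordant.contDiffAt_gradient (hf : IsSelfConcordant M D f) {x : E N}
    (hx : x ∈ D) : ContDiffAt ℝ 2 (gradient f) x := by
  have h : ContDiffAt ℝ 2 (fderiv ℝ f) x := (hf.contDiffAt hx).fderiv_right (by norm_num)
  exact (InnerProductSpace.toDual ℝ (E N)).symm.toContinuousLinearEquiv.contDiff.contDiffAt.comp x h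

theorem IsSelfConcordant.hasFDerivAt_gradient (hf : IsSelfConcordant M D f) {x : E N}
    (hx : x ∈ D) : HasFDerivAt (gradient f) (hess f x) x :=
  ((hf.contDiffAt_gradient hx).differentiableAt (by norm_num)).hasFDerivAt

theorem IsSelfConcordant.differentiableAt_hess (hf : IsSelfConcordant M D f) {x : E N}
    (hx : x ∈ D) : DifferentiableAt ℝ (hess f) x :=
  ((hf.contDiffAt_gradient hx).fderiv_right (m := 1) (by norm_num)).differentiableAt (by norm_num)

theorem IsSelfConcordant.inner_hess_comm (hf : IsSelfConcordant M D f) {x : E N} (hx : x ∈ D)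
    (u w : E N) : inner ℝ u (hess f x w) = inner ℝ w (hess f x u) := by
  have hs : IsSymmSndFDerivAt ℝ f x := (hf.contDiffAt hx).isSymmSndFDerivAt (by simp; norm_num)
  have key : ∀ a b : E N, inner ℝ a (hess f x b) = fderiv ℝ (fderiv ℝ f) x b a := by
    intro a b
    have h1 : HasFDerivAt (fderiv ℝ f)
        ((InnerProductSpace.toDual ℝ (E N)).toContinuousLinearEquiv.toContinuousLinearMap.comp
          (hess f x)) x := by
      rw [← toDual_comp_gradient]
      exact (InnerProductSpace.toDual ℝ (E N)).toContinuousLinearEquiv.hasFDerivAt.comp x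
        (hf.hasFDerivAt_gradient hx)
    rw [h1.fderiv]
    simp [real_inner_comm]
  rw [key, key, hs]

theorem hasDerivAt_line (x u : E N) (t : ℝ) : HasDerivAt (fun t : ℝ => x + t • u) u t := by
  simpa using ((hasDerivAt_id t).smul_const u).const_add x

theorem IsSelfConcordant.hasDerivAt_comp_line (hf : IsSelfConcordant M D f) {x u : E N} {t : ℝ}
    (ht : x + t • u ∈ D) :
    HasDerivAt (fun t : ℝ => f (x + t • u)) (inner ℝ u (gradient f (x + t • u))) t := by
  have h := (hf.hasGradientAt ht).hasFDerivAt.comp_hasDerivAt t (hasDerivAt_line x u t)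
  refine h.congr_deriv ?_
  simp

theorem IsSelfConcordant.hasDerivAt_inner_gradient (hf : IsSelfConcordant M D f) {x u : E N}
    {t : ℝ} (ht : x + t • u ∈ D) :
    HasDerivAt (fun t : ℝ => inner ℝ u (gradient f (x + t • u)))
      (inner ℝ u (hess f (x + t • u) u)) t := by
  have h := (hf.hasFDerivAt_gradient ht).comp_hasDerivAt t (hasDerivAt_line x u t)
  exact (innerSL ℝ u).hasFDerivAt.comp_hasDerivAt t h

theorem IsSelfConcordant.differentiableAt_inner_hess (hf : IsSelfConcordant M D f) {x u : E N}
    {t : ℝ} (ht : x + t • u ∈ D) :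
    DifferentiableAt ℝ (fun t : ℝ => inner ℝ u (hess f (x + t • u) u)) t := by
  have h1 : DifferentiableAt ℝ (fun t : ℝ => hess f (x + t • u)) t :=
    (hf.differentiableAt_hess ht).comp t (hasDerivAt_line x u t).differentiableAt
  exact (differentiableAt_const u).inner ℝ (h1.clm_apply (differentiableAt_const u))

theorem IsSelfConcordant.eventually_mem (hf : IsSelfConcordant M D f) {x u : E N} {t : ℝ}
    (ht : x + t • u ∈ D) : ∀ᶠ s in 𝓝 t, x + s • u ∈ D :=
  (hasDerivAt_line x u t).continuousAt.eventually (hf.isOpen_dom.mem_nhds ht)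

theorem IsSelfConcordant.iteratedDeriv_two (hf : IsSelfConcordant M D f) {x u : E N} {t : ℝ}
    (ht : x + t • u ∈ D) :
    iteratedDeriv 2 (fun t : ℝ => f (x + t • u)) t = inner ℝ u (hess f (x + t • u) u) := by
  have h : deriv (fun t : ℝ => f (x + t • u)) =ᶠ[𝓝 t]
      fun t => inner ℝ u (gradient f (x + t • u)) :=
    (hf.eventually_mem ht).mono fun s hs => (hf.hasDerivAt_comp_line hs).deriv
  rw [iteratedDeriv_succ, iteratedDeriv_one, h.deriv_eq, (hf.hasDerivAt_inner_gradient ht).deriv]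

theorem IsSelfConcordant.abs_deriv_inner_hess_le (hf : IsSelfConcordant M D f) {x u : E N} {t : ℝ}
    (ht : x + t • u ∈ D) :
    |deriv (fun t : ℝ => inner ℝ u (hess f (x + t • u) u)) t| ≤
      M * (inner ℝ u (hess f (x + t • u) u)) ^ (3 / 2 : ℝ) := by
  -- The defining inequality is only about parameter `0`, so the line is re-based at `x + t • u`.
  have h0 : x + t • u + (0 : ℝ) • u ∈ D := by simpa using ht
  have h := hf.third_le _ ht u
  rw [hf.iteratedDeriv_two h0, iteratedDeriv_succ] at h
  have h2 : iteratedDeriv 2 (fun s : ℝ => f (x + t • u + s • u)) =ᶠ[𝓝 0]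
      fun s => inner ℝ u (hess f (x + (t + s) • u) u) :=
    (hf.eventually_mem h0).mono fun s hs => by
      rw [hf.iteratedDeriv_two hs, add_assoc, ← add_smul]
  rw [h2.deriv_eq, deriv_comp_const_add (f := fun s => inner ℝ u (hess f (x + s • u) u))] at h
  simpa using h

theorem line_mem (hD : Convex ℝ D) {x u : E N} (hx : x ∈ D) {T : ℝ} (hT : x + T • u ∈ D) {t : ℝ}
    (ht : t ∈ Set.Icc 0 T) : x + t • u ∈ D := by
  have hc : Convex ℝ ((fun t : ℝ => x + t • u) ⁻¹' D) := by
    intro a ha b hb α β hα hβ hαβ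
    have h := hD (Set.mem_preimage.1 ha) (Set.mem_preimage.1 hb) hα hβ hαβ
    rw [Set.mem_preimage]
    convert h using 1
    rw [eq_sub_of_add_eq hαβ]
    simp only [smul_eq_mul]
    module
  exact hc.ordConnected.out (by simpa using hx) hT ht

/-! ### Upper and lower models, Dikin ellipsoid -/

theorem localNorm_nonneg (x u : E N) : 0 ≤ localNorm f x u := Real.sqrt_nonneg _

theorem IsSelfConcordant.lower_bound (hf : IsSelfConcordant 2 D f)
    (hpd : ∀ x ∈ D, ∀ u : E N, u ≠ 0 → 0 < inner ℝ u (hess f x u)) {x y : E N}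
    (hx : x ∈ D) (hy : y ∈ D) :
    f x + inner ℝ (y - x) (gradient f x) + omega (localNorm f x (y - x)) ≤ f y := by
  rcases eq_or_ne (y - x) 0 with h | h
  · rw [sub_eq_zero.1 h]
    simp [localNorm, omega_zero]
  have h1 : x + (1 : ℝ) • (y - x) = y := by simp
  have hm : ∀ t ∈ Set.Icc (0 : ℝ) 1, x + t • (y - x) ∈ D := fun t ht =>
    line_mem hf.convexOn.1 hx (h1.symm ▸ hy) ht
  have := lower_bound_one_variable zero_le_one (fun t ht => hf.hasDerivAt_comp_line (hm t ht))
    (fun t ht => hf.hasDerivAt_inner_gradient (hm t ht))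
    (fun t ht => (hf.differentiableAt_inner_hess (hm t ht)).hasDerivAt)
    (fun t ht => hpd _ (hm t ht) _ h) (fun t ht => hf.abs_deriv_inner_hess_le (hm t ht))
  simpa [localNorm] using this

/-- The endpoint is assumed to lie in `D` because this bound serves to prove the Dikin inclusion;
`upper_bound` then drops the assumption. -/
theorem IsSelfConcordant.upper_bound_line (hf : IsSelfConcordant 2 D f)
    (hpd : ∀ x ∈ D, ∀ u : E N, u ≠ 0 → 0 < inner ℝ u (hess f x u)) {x u : E N}
    (hx : x ∈ D) {T : ℝ} (hT : 0 ≤ T) (hTD : x + T • u ∈ D) (hT1 : localNorm f x u * T < 1) :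
    f (x + T • u) ≤ f x + inner ℝ u (gradient f x) * T + omegaStar (localNorm f x u * T) := by
  rcases eq_or_ne u 0 with rfl | h
  · simp [localNorm, omegaStar_zero]
  have hm : ∀ t ∈ Set.Icc (0 : ℝ) T, x + t • u ∈ D := fun t ht =>
    line_mem hf.convexOn.1 hx hTD ht
  have := upper_bound_one_variable hT (fun t ht => hf.hasDerivAt_comp_line (hm t ht))
    (fun t ht => hf.hasDerivAt_inner_gradient (hm t ht))
    (fun t ht => (hf.differentiableAt_inner_hess (hm t ht)).hasDerivAt)
    (fun t ht => hpd _ (hm t ht) _ h) (fun t ht => hf.abs_deriv_inner_hess_le (hm t ht))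
    (by simpa [localNorm] using hT1)
  simpa [localNorm] using this

/-- The Dikin ellipsoid is contained in the domain. -/
theorem IsSelfConcordant.add_mem_of_localNorm_lt_one (hf : IsSelfConcordant 2 D f)
    (hpd : ∀ x ∈ D, ∀ u : E N, u ≠ 0 → 0 < inner ℝ u (hess f x u)) {x u : E N}
    (hx : x ∈ D) (hu : localNorm f x u < 1) : x + u ∈ D := by
  have hu0 := localNorm_nonneg (f := f) x u
  set B : ℝ := f x + |inner ℝ u (gradient f x)| + omegaStar (localNorm f x u) with hB
  have hlt : ∀ t ∈ Set.Icc (0 : ℝ) 1, localNorm f x u * t ≤ localNorm f x u := fun t ht =>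
    mul_le_of_le_one_right hu0 ht.2
  have hbd : ∀ t ∈ Set.Icc (0 : ℝ) 1, x + t • u ∈ D → f (x + t • u) ≤ B := by
    intro t ht htD
    have h1 := hf.upper_bound_line hpd hx ht.1 htD ((hlt t ht).trans_lt hu)
    have h2 : omegaStar (localNorm f x u * t) ≤ omegaStar (localNorm f x u) :=
      omegaStar_strictMonoOn.monotoneOn ⟨mul_nonneg hu0 ht.1, (hlt t ht).trans_lt hu⟩ ⟨hu0, hu⟩
        (hlt t ht)
    have h3 : inner ℝ u (gradient f x) * t ≤ |inner ℝ u (gradient f x)| :=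
      (mul_le_mul_of_nonneg_right (le_abs_self _) ht.1).trans
        (mul_le_of_le_one_right (abs_nonneg _) ht.2)
    linarith
  -- As `f ≤ B` along the segment inside `D`, membership in `D` equals membership of `(x + t • u,
  -- B)` in the closed epigraph. The set of such `t` is also open and contains `0`, hence is all of
  -- `[0, 1]`.
  have hclosed : IsClosed ({t : ℝ | x + t • u ∈ D} ∩ Set.Icc 0 1) := by
    have hc : Continuous fun t : ℝ => (x + t • u, B) := by fun_prop
    have := (hf.isClosed_epigraph.preimage hc).inter (isClosed_Icc (a := (0 : ℝ)) (b := 1))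
    convert this using 1
    ext t
    exact ⟨fun h => ⟨⟨h.1, hbd t h.2 h.1⟩, h.2⟩, fun h => ⟨h.1.1, h.2⟩⟩
  have hsub := hclosed.Icc_subset_of_forall_mem_nhdsWithin (by simpa using hx)
    (fun t ht => mem_nhdsWithin_of_mem_nhds (hf.eventually_mem ht.1))
  simpa using hsub (Set.right_mem_Icc.2 zero_le_one)

theorem IsSelfConcordant.upper_bound (hf : IsSelfConcordant 2 D f)
    (hpd : ∀ x ∈ D, ∀ u : E N, u ≠ 0 → 0 < inner ℝ u (hess f x u)) {x u : E N}
    (hx : x ∈ D) (hu : localNorm f x u < 1) :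
    f (x + u) ≤ f x + inner ℝ u (gradient f x) + omegaStar (localNorm f x u) := by
  have := hf.upper_bound_line hpd hx zero_le_one
    (by simpa using hf.add_mem_of_localNorm_lt_one hpd hx hu) (by simpa using hu)
  simpa using this

theorem localNorm_smul {x u : E N} {a : ℝ} (ha : 0 ≤ a) :
    localNorm f x (a • u) = a * localNorm f x u := by
  rw [localNorm, localNorm, map_smul, inner_smul_left, inner_smul_right, ← mul_assoc]
  simp [Real.sqrt_mul_self ha, Real.sqrt_mul (mul_self_nonneg a)]

/-! ### Newton decrement and one inexact step -/

section Newton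

variable {x : E N}

theorem inner_hess_self_nonneg
    (hpd : ∀ x ∈ D, ∀ u : E N, u ≠ 0 → 0 < inner ℝ u (hess f x u)) (hx : x ∈ D) (u : E N) :
    0 ≤ inner ℝ u (hess f x u) := by
  rcases eq_or_ne u 0 with rfl | h
  · simp
  · exact (hpd x hx u h).le

theorem sq_localNorm
    (hpd : ∀ x ∈ D, ∀ u : E N, u ≠ 0 → 0 < inner ℝ u (hess f x u)) (hx : x ∈ D) (u : E N) :
    localNorm f x u ^ 2 = inner ℝ u (hess f x u) :=
  Real.sq_sqrt (inner_hess_self_nonneg hpd hx u)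

/-- Cauchy-Schwarz for the Hessian form: `t ↦ ‖u + t w‖_x²` is a nonnegative quadratic, so its
discriminant is at most `0`. -/
theorem IsSelfConcordant.abs_inner_hess_le (hf : IsSelfConcordant M D f)
    (hpd : ∀ x ∈ D, ∀ u : E N, u ≠ 0 → 0 < inner ℝ u (hess f x u)) (hx : x ∈ D) (u w : E N) :
    |inner ℝ u (hess f x w)| ≤ localNorm f x u * localNorm f x w := by
  have hq : ∀ t : ℝ, 0 ≤ localNorm f x w ^ 2 * (t * t) + 2 * inner ℝ u (hess f x w) * t +
      localNorm f x u ^ 2 := by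
    intro t
    have h := inner_hess_self_nonneg hpd hx (u + t • w)
    have h1 : inner ℝ (u + t • w) (hess f x (u + t • w)) =
        localNorm f x w ^ 2 * (t * t) + 2 * inner ℝ u (hess f x w) * t + localNorm f x u ^ 2 := by
      rw [sq_localNorm hpd hx, sq_localNorm hpd hx]
      simp only [map_add, map_smul, inner_add_left, inner_add_right, inner_smul_left,
        inner_smul_right, hf.inner_hess_comm hx w u]
      simp
      ring
    rwa [← h1]
  have hd := discrim_le_zero hq
  rw [discrim] at hd
  refine abs_le_of_sq_le_sq ?_ (mul_nonneg (localNorm_nonneg _ _) (localNorm_nonneg _ _))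
  nlinarith

theorem exists_newton_direction
    (hpd : ∀ x ∈ D, ∀ u : E N, u ≠ 0 → 0 < inner ℝ u (hess f x u)) (hx : x ∈ D) :
    ∃ n : E N, hess f x n = gradient f x := by
  have hinj : Function.Injective (hess f x : E N →ₗ[ℝ] E N) := by
    rw [injective_iff_map_eq_zero]
    intro u hu
    by_contra h
    have := hpd x hx u h
    rw [show hess f x u = 0 from hu] at this
    simp at this
  exact LinearMap.injective_iff_surjective.1 hinj (gradient f x)

/-- The optimality gap is bounded through the Newton decrement `‖n‖_x`. -/
theorem IsSelfConcordant.sub_le_omegaStar (hf : IsSelfConcordant 2 D f)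
    (hpd : ∀ x ∈ D, ∀ u : E N, u ≠ 0 → 0 < inner ℝ u (hess f x u)) (hx : x ∈ D) {n y : E N}
    (hn : hess f x n = gradient f x) (hy : y ∈ D) (hn1 : localNorm f x n < 1) :
    f x - f y ≤ omegaStar (localNorm f x n) := by
  have h1 := hf.lower_bound hpd hx hy
  have h2 := (abs_le.1 (hf.abs_inner_hess_le hpd hx (y - x) n)).1
  rw [hn] at h2
  have h3 := mul_sub_omega_le_omegaStar hn1 (localNorm_nonneg (f := f) x (y - x))
  linarith

/-- A direction with small relative residual is close to the Newton direction in the local norm. -/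
theorem IsSelfConcordant.localNorm_sub_le (hf : IsSelfConcordant M D f)
    (hpd : ∀ x ∈ D, ∀ u : E N, u ≠ 0 → 0 < inner ℝ u (hess f x u)) (hx : x ∈ D) {S : Set (E N)}
    {lam L : ℝ} (hbd : HessianBounds f S lam L) (hxS : x ∈ S) {n v : E N} {θ : ℝ} (hθ : 0 ≤ θ)
    (hn : hess f x n = gradient f x)
    (hv : ‖hess f x v - gradient f x‖ ≤ θ * √(lam / L) * ‖gradient f x‖) :
    localNorm f x (v - n) ≤ θ * localNorm f x n := by
  have hL : 0 < L := hbd.pos.trans_le hbd.le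
  have hsl : 0 < √lam := Real.sqrt_pos.2 hbd.pos
  have hsL : 0 < √L := Real.sqrt_pos.2 hL
  have hlow : ∀ w : E N, √lam * ‖w‖ ≤ localNorm f x w := by
    intro w
    have := Real.sqrt_le_sqrt (hbd.lower x hxS w)
    rwa [Real.sqrt_mul hbd.pos.le, Real.sqrt_sq (norm_nonneg w)] at this
  have hup : ∀ w : E N, localNorm f x w ≤ √L * ‖w‖ := by
    intro w
    have := Real.sqrt_le_sqrt (hbd.upper x hxS w)
    rwa [Real.sqrt_mul hL.le, Real.sqrt_sq (norm_nonneg w)] at this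
  -- With `g` the gradient and `H` the Hessian: `‖g‖² = ⟨g, H n⟩ ≤ ‖g‖_x ‖n‖_x ≤ √L ‖g‖ ‖n‖_x`.
  have hg : ‖gradient f x‖ ≤ √L * localNorm f x n := by
    rcases (norm_nonneg (gradient f x)).eq_or_lt with h | h
    · rw [← h]
      exact mul_nonneg hsL.le (localNorm_nonneg _ _)
    · have h1 := (le_abs_self _).trans (hf.abs_inner_hess_le hpd hx (gradient f x) n)
      rw [hn, real_inner_self_eq_norm_sq] at h1
      have h2 := mul_le_mul_of_nonneg_right (hup (gradient f x)) (localNorm_nonneg (f := f) x n)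
      nlinarith
  -- For `e = v - n` the residual is `H e`, and `‖e‖_x² = ⟨e, H e⟩ ≤ ‖e‖ ‖H e‖` with `√lam ‖e‖ ≤
  -- ‖e‖_x`.
  have he : √lam * localNorm f x (v - n) ≤ ‖hess f x v - gradient f x‖ := by
    rcases (localNorm_nonneg (f := f) x (v - n)).eq_or_lt with h | h
    · rw [← h]
      simp
    · have h1 := real_inner_le_norm (v - n) (hess f x (v - n))
      rw [← sq_localNorm hpd hx, map_sub, hn] at h1
      have h2 := mul_le_mul_of_nonneg_right (hlow (v - n))
        (norm_nonneg (hess f x v - gradient f x))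
      nlinarith
  have h3 : √lam * localNorm f x (v - n) ≤ √lam * (θ * localNorm f x n) := by
    refine he.trans (hv.trans ?_)
    calc θ * √(lam / L) * ‖gradient f x‖ ≤ θ * √(lam / L) * (√L * localNorm f x n) := by gcongr
      _ = √lam * (θ * localNorm f x n) := by
        rw [Real.sqrt_div hbd.pos.le]
        field_simp
  exact le_of_mul_le_mul_left h3 hsl

/-- One inexact damped Newton step. -/
theorem IsSelfConcordant.inexact_step (hf : IsSelfConcordant 2 D f)
    (hpd : ∀ x ∈ D, ∀ u : E N, u ≠ 0 → 0 < inner ℝ u (hess f x u)) (hx : x ∈ D) {n v : E N}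
    (hn : hess f x n = gradient f x) (hvn : localNorm f x (v - n) ≤ 1 / 20 * localNorm f x n) :
    x - (1 / (1 + localNorm f x v)) • v ∈ D ∧
      f (x - (1 / (1 + localNorm f x v)) • v) ≤ f x - 4 / 5 * omega (localNorm f x n) := by
  set m := localNorm f x n with hm
  set t := localNorm f x v with ht
  have hm0 : 0 ≤ m := localNorm_nonneg _ _
  have ht0 : 0 ≤ t := localNorm_nonneg _ _
  have ht1 : 0 < 1 + t := by linarith
  have hneg : localNorm f x (-((1 / (1 + t)) • v)) = t / (1 + t) := by
    have : localNorm f x (-((1 / (1 + t)) • v)) = localNorm f x ((1 / (1 + t)) • v) := by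
      simp [localNorm]
    rw [this, localNorm_smul (by positivity), ← ht]
    ring
  -- Damping gives the step local norm `t/(1+t) < 1`, whatever the size of `v`.
  have hlt : localNorm f x (-((1 / (1 + t)) • v)) < 1 := by
    rw [hneg, div_lt_one ht1]
    linarith
  have hp : t ^ 2 - m / 20 * t ≤ inner ℝ v (gradient f x) := by
    have h1 := (abs_le.1 (hf.abs_inner_hess_le hpd hx v (v - n))).2
    rw [map_sub, inner_sub_right, hn, ← sq_localNorm hpd hx, ← ht] at h1
    have h2 := mul_le_mul_of_nonneg_left hvn ht0
    linarith
  -- Both sides of `19/20 m² ≤ ⟨n, H v⟩ ≤ m t` come from Cauchy-Schwarz.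
  have htm : 19 / 20 * m ≤ t := by
    have h1 := (abs_le.1 (hf.abs_inner_hess_le hpd hx n (v - n))).1
    have h2 := (abs_le.1 (hf.abs_inner_hess_le hpd hx n v)).2
    rw [map_sub, inner_sub_right, ← sq_localNorm hpd hx, ← hm] at h1
    rw [← hm, ← ht] at h2
    have h3 := mul_le_mul_of_nonneg_left hvn hm0
    rcases hm0.eq_or_lt with h | h
    · rw [← h]
      simpa using ht0
    · nlinarith
  have hdec := omega_le_decrease hm0 htm hp
  have hub := hf.upper_bound hpd hx hlt
  rw [hneg, inner_neg_left, inner_smul_left] at hub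
  refine ⟨?_, ?_⟩
  · rw [sub_eq_add_neg]
    exact hf.add_mem_of_localNorm_lt_one hpd hx hlt
  · rw [sub_eq_add_neg]
    refine hub.trans ?_
    have : (starRingEnd ℝ) (1 / (1 + t)) * inner ℝ v (gradient f x) =
      inner ℝ v (gradient f x) / (1 + t) := by simp; ring
    rw [this]
    linarith

end Newton

end SelfConcordant

end InexactDN
namespace InexactDN

/-! ### Counting iterations -/

section Counting

variable {δ μ : ℕ → ℝ}

/-- A decrement above `1/6` would lower the objective by more than the whole remaining gap. -/
theorem le_one_sixth_of_gap_le {d m : ℝ} (hdec : 4 / 5 * omega m ≤ d)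
    (h : d ≤ omega (1 / 6) / 2) : m ≤ 1 / 6 := by
  by_contra! hlt
  have h1 := omega_mono (by norm_num) hlt.le
  have h2 := omega_pos (show (0 : ℝ) < 1 / 6 by norm_num)
  linarith

/-- At `r = 1/6` the ratio is `5/7`, so `5/7 δ k ≤ ω(μ k) ≤ ω(1/6)` and `δ (k+1) ≤ (1 - 4/7) δ k`.
Thus `δ (k+1) ≤ 3/5 ω(1/6)`, too small to allow a decrease of `4/5 ω(1/6)`; this keeps the next
decrement below `1/6`. -/
theorem halving_step (hδ : ∀ k, 0 ≤ δ k) (hμ : ∀ k, 0 ≤ μ k)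
    (hdec : ∀ k, δ (k + 1) ≤ δ k - 4 / 5 * omega (μ k))
    (hgap : ∀ k, μ k < 1 → δ k ≤ omegaStar (μ k)) {k : ℕ} (hk : μ k ≤ 1 / 6) :
    δ k ≤ 7 / 5 * omega (1 / 6) ∧ δ (k + 1) ≤ δ k / 2 ∧ μ (k + 1) ≤ 1 / 6 := by
  have hk1 : μ k < 1 := by linarith
  have h1 : δ k ≤ omegaStar (1 / 6) := (hgap k hk1).trans <|
    omegaStar_strictMonoOn.monotoneOn ⟨hμ k, hk1⟩ ⟨by norm_num, by norm_num⟩ hk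
  have h2 := ratio_mul_le_omega (hδ k) (by norm_num) (by norm_num) h1 (hμ k) (hgap k)
  norm_num at h2
  have h3 := omega_mono (hμ k) hk
  have h4 := hdec k
  have h5 := hδ k
  refine ⟨by linarith, by linarith, ?_⟩
  by_contra! hlt
  have h6 := omega_mono (by norm_num) hlt.le
  have h7 := hdec (k + 1)
  have h8 := hδ (k + 1 + 1)
  have h9 := omega_pos (show (0 : ℝ) < 1 / 6 by norm_num)
  linarith

theorem gap_le_of_small_decrement (hδ : ∀ k, 0 ≤ δ k) (hμ : ∀ k, 0 ≤ μ k)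
    (hdec : ∀ k, δ (k + 1) ≤ δ k - 4 / 5 * omega (μ k))
    (hgap : ∀ k, μ k < 1 → δ k ≤ omegaStar (μ k)) {k : ℕ} (hk : μ k ≤ 1 / 6) (j : ℕ) :
    δ (k + j) ≤ 2 * omega (1 / 6) / 2 ^ j ∧ μ (k + j) ≤ 1 / 6 := by
  induction j with
  | zero =>
    have h1 := (halving_step hδ hμ hdec hgap hk).1
    have h2 := omega_pos (show (0 : ℝ) < 1 / 6 by norm_num)
    exact ⟨by simp only [add_zero, pow_zero, div_one]; linarith, hk⟩
  | succ j ih =>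
    obtain ⟨-, h1, h2⟩ := halving_step hδ hμ hdec hgap ih.2
    refine ⟨?_, h2⟩
    rw [pow_succ, ← div_div]
    rw [← add_assoc]
    linarith [ih.1]

theorem exists_small_decrement_of_constant_decrease (hδ : ∀ k, 0 ≤ δ k)
    (hdec : ∀ k, δ (k + 1) ≤ δ k - 4 / 5 * omega (μ k)) :
    ∃ k ≤ ⌈2 * δ 0 / omega (1 / 6)⌉₊, μ k ≤ 1 / 6 := by
  have h2 := omega_pos (show (0 : ℝ) < 1 / 6 by norm_num)
  by_contra! hlt
  set K := ⌈2 * δ 0 / omega (1 / 6)⌉₊ with hK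
  -- Each step with `μ > 1/6` gains at least `4/5 ω(1/6)`, of which only `1/2 ω(1/6)` is kept; after
  -- `K` steps no gap would remain.
  have hlin : ∀ k ≤ K, δ k ≤ δ 0 - k * (omega (1 / 6) / 2) := by
    intro k
    induction k with
    | zero => simp
    | succ k ih =>
      intro hk
      have h1 := ih (by omega)
      have h3 := omega_mono (by norm_num) (hlt k (by omega)).le
      have h4 := hdec k
      push_cast
      linarith
  have h1 := hlin K le_rfl
  have h3 : 2 * δ 0 / omega (1 / 6) ≤ K := Nat.le_ceil _
  rw [div_le_iff₀ h2] at h3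
  refine absurd (le_one_sixth_of_gap_le (d := δ K) ?_ (by linarith)) (not_le.2 (hlt K le_rfl))
  linarith [hdec K, hδ (K + 1)]

theorem exists_small_decrement_of_linear_rate (hδ : ∀ k, 0 ≤ δ k) (hμ : ∀ k, 0 ≤ μ k)
    (hdec : ∀ k, δ (k + 1) ≤ δ k - 4 / 5 * omega (μ k))
    (hgap : ∀ k, μ k < 1 → δ k ≤ omegaStar (μ k)) :
    ∃ k ≤ ⌈(Real.log (omega (1 / 6) / 2) - Real.log (δ 0)) /
        Real.log (1 - (1 - omegaStarInv (δ 0)) / (2 * (1 + omegaStarInv (δ 0))))⌉₊,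
      μ k ≤ 1 / 6 := by
  have h2 := omega_pos (show (0 : ℝ) < 1 / 6 by norm_num)
  have hsmall : ∀ k, δ k ≤ omega (1 / 6) / 2 → μ k ≤ 1 / 6 := fun k hk =>
    le_one_sixth_of_gap_le (d := δ k) (by linarith [hdec k, hδ (k + 1)]) hk
  -- For `δ 0 = 0` the index `0` works, whatever value the quotient with `log 0` takes.
  rcases (hδ 0).eq_or_lt with h0 | h0
  · exact ⟨0, Nat.zero_le _, hsmall 0 (by linarith)⟩
  obtain ⟨hr0, hr1⟩ := omegaStarInv_mem (hδ 0)
  have hr := omegaStar_omegaStarInv (hδ 0)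
  set r := omegaStarInv (δ 0)
  set q := 1 - (1 - r) / (2 * (1 + r)) with hq
  set K := ⌈(Real.log (omega (1 / 6) / 2) - Real.log (δ 0)) / Real.log q⌉₊
  have hq' : q = 1 - (1 - r) / (1 + r) / 2 := by rw [hq, mul_comm 2, div_div]
  have hc0 : 0 < (1 - r) / (1 + r) := div_pos (by linarith) (by linarith)
  have hc1 : (1 - r) / (1 + r) ≤ 1 := (div_le_one (by linarith)).2 (by linarith)
  have hq0 : 0 < q := by linarith
  have hq1 : q < 1 := by linarith
  have hanti : Antitone δ := antitone_nat_of_succ_le fun k => by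
    linarith [hdec k, omega_nonneg (hμ k)]
  have hrate : ∀ k, δ k ≤ q ^ k * δ 0 := by
    intro k
    induction k with
    | zero => simp
    | succ k ih =>
      -- The gaps decrease, so the initial `r` remains valid at every step.
      have h1 := ratio_mul_le_omega (hδ k) hr0 hr1 (hr ▸ hanti (Nat.zero_le k)) (hμ k) (hgap k)
      have h3 : δ (k + 1) ≤ q * δ k := by
        rw [hq']
        linarith [hdec k, omega_nonneg (hμ k)]
      calc δ (k + 1) ≤ q * δ k := h3
        _ ≤ q * (q ^ k * δ 0) := by gcongr
        _ = _ := by ring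
  refine ⟨K, le_rfl, hsmall K ((hrate K).trans ?_)⟩
  have hK := Nat.le_ceil ((Real.log (omega (1 / 6) / 2) - Real.log (δ 0)) / Real.log q)
  rw [div_le_iff_of_neg (Real.log_neg hq0 hq1)] at hK
  rw [← Real.log_le_log_iff (by positivity) (by positivity),
    Real.log_mul (by positivity) h0.ne', Real.log_pow]
  linarith

theorem exists_iteration_gap_le (hδ : ∀ k, 0 ≤ δ k) (hμ : ∀ k, 0 ≤ μ k)
    (hdec : ∀ k, δ (k + 1) ≤ δ k - 4 / 5 * omega (μ k))
    (hgap : ∀ k, μ k < 1 → δ k ≤ omegaStar (μ k)) {ε : ℝ} (hε : 0 < ε) :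
    ∃ k : ℕ,
      k ≤ min
            ⌈(Real.log (omega (1 / 6) / 2) - Real.log (δ 0)) /
              Real.log (1 - (1 - omegaStarInv (δ 0)) / (2 * (1 + omegaStarInv (δ 0))))⌉₊
            ⌈2 * δ 0 / omega (1 / 6)⌉₊
          + ⌈Real.logb 2 (2 * omega (1 / 6) / ε)⌉₊ ∧
      δ k ≤ ε := by
  have h2 := omega_pos (show (0 : ℝ) < 1 / 6 by norm_num)
  obtain ⟨a, ha, hμa⟩ := exists_small_decrement_of_linear_rate hδ hμ hdec hgap
  obtain ⟨b, hb, hμb⟩ := exists_small_decrement_of_constant_decrease hδ hdec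
  -- Both counts reach the same condition `μ ≤ 1/6`, so the earlier index may start the halving
  -- phase. In the counts, `⌈·⌉₊` vanishes on negative numbers and so includes the positive part.
  have hmin : μ (min a b) ≤ 1 / 6 := by
    rcases min_choice a b with h | h <;> rw [h] <;> assumption
  set j := ⌈Real.logb 2 (2 * omega (1 / 6) / ε)⌉₊
  refine ⟨min a b + j, Nat.add_le_add_right (min_le_min ha hb) j,
    (gap_le_of_small_decrement hδ hμ hdec hgap hmin j).1.trans ?_⟩
  have hj : Real.logb 2 (2 * omega (1 / 6) / ε) ≤ j := Nat.le_ceil _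
  rw [Real.logb_le_iff_le_rpow (by norm_num) (by positivity), Real.rpow_natCast,
    div_le_iff₀ hε] at hj
  rw [div_le_iff₀ (by positivity)]
  linarith

end Counting

end InexactDN

theorem mainTheorem8 {N : ℕ} (D : Set (InexactDN.E N)) (f : InexactDN.E N → ℝ)
    -- the problem: `f` is standard self-concordant, `g = 0`, so that `F = f`
    (hf : InexactDN.IsSelfConcordant 2 D f)
    (hpd : ∀ x ∈ D, ∀ u : InexactDN.E N, u ≠ 0 → 0 < inner ℝ u (InexactDN.hess f x u))
    (hmin : ∃! xs : InexactDN.E N, xs ∈ D ∧ IsMinOn f D xs)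
    -- a run of the method from `x 0`, with Zhang and Xiao's tolerances
    (x v : ℕ → InexactDN.E N) (hx0 : x 0 ∈ D)
    (lam L : ℝ)
    (hbd : InexactDN.HessianBounds f (InexactDN.levelSet D f (x 0)) lam L)
    (hrun : InexactDN.IsInexactDampedNewton f
      (fun k => 1 / 20 * √(lam / L) * ‖gradient f (x k)‖) x v)
    (ε : ℝ) (hε : 0 < ε)
    (δ₀ : ℝ) (hδ₀ : δ₀ = f (x 0) - InexactDN.optVal D f) :
    (∀ k, x k ∈ D) ∧
    ∃ k : ℕ,
      k ≤ min
            ⌈(Real.log (InexactDN.omega (1 / 6) / 2) - Real.log δ₀) /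
              Real.log (1 - (1 - InexactDN.omegaStarInv δ₀) /
                (2 * (1 + InexactDN.omegaStarInv δ₀)))⌉₊
            ⌈2 * δ₀ / InexactDN.omega (1 / 6)⌉₊
          + ⌈Real.logb 2 (2 * InexactDN.omega (1 / 6) / ε)⌉₊ ∧
      f (x k) - InexactDN.optVal D f ≤ ε := by

  obtain ⟨xs, ⟨hxs, hxmin⟩, -⟩ := hmin
  have hopt : InexactDN.optVal D f = f xs :=
    IsLeast.csInf_eq ⟨Set.mem_image_of_mem f hxs, by
      rintro _ ⟨y, hy, rfl⟩
      exact hxmin hy⟩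
  have hstep : ∀ k, x k ∈ D → f (x k) ≤ f (x 0) → ∀ n,
      InexactDN.hess f (x k) n = gradient f (x k) → x (k + 1) ∈ D ∧
        f (x (k + 1)) ≤ f (x k) - 4 / 5 * InexactDN.omega (InexactDN.localNorm f (x k) n) := by
    intro k hk hk0 n hn
    rw [hrun.update k]
    exact hf.inexact_step hpd hk hn
      (hf.localNorm_sub_le hpd hk hbd ⟨hk, hk0⟩ (by norm_num) hn (hrun.residual_le k))
  -- The Hessian bounds hold only on the initial level set, so membership in `D` and in that level
  -- set must be carried together.
  have hinv : ∀ k, x k ∈ D ∧ f (x k) ≤ f (x 0) := by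
    intro k
    induction k with
    | zero => exact ⟨hx0, le_rfl⟩
    | succ k ih =>
      obtain ⟨n, hn⟩ := InexactDN.exists_newton_direction hpd ih.1
      obtain ⟨h1, h2⟩ := hstep k ih.1 ih.2 n hn
      have h3 := InexactDN.omega_nonneg (InexactDN.localNorm_nonneg (f := f) (x k) n)
      exact ⟨h1, by linarith [ih.2]⟩
  refine ⟨fun k => (hinv k).1, ?_⟩
  choose n hn using fun k => InexactDN.exists_newton_direction hpd (hinv k).1
  rw [hopt] at hδ₀ ⊢
  subst hδ₀
  refine InexactDN.exists_iteration_gap_le (δ := fun k => f (x k) - f xs)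
    (μ := fun k => InexactDN.localNorm f (x k) (n k)) (fun k => sub_nonneg.2 (hxmin (hinv k).1))
    (fun k => InexactDN.localNorm_nonneg _ _) (fun k => ?_)
    (fun k hk => hf.sub_le_omegaStar hpd (hinv k).1 (hn k) hxs hk) hε
  have := (hstep k (hinv k).1 (hinv k).2 (n k) (hn k)).2
  linarith
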